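/- Let $A$ be a finite alphabet and let $S\subseteq A^*$ be uniformly recurrent: $S$ contains all factors of its elements, every $u\in S$ has $ua\in S$ for some letter $a\in A$, and for every $u\in S$ there is an integer $n\ge 1$ such that $u$ is a factor of every word of $S$ of length $n$. A bifix code is a set of nonempty words none of which is a proper prefix or a proper suffix of another; a bifix code $X\subseteq S$ is $S$-maximal if it is not properly contained in a bifix code $Z\subseteq S$. A parse of a word $s$ with respect to $X$ is a triple $(v,x,u)$ with $s=vxu$, where $v$ has no suffix in $X$, $u$ has no prefix in $X$, and $x$ belongs to the submonoid $X^*$ generated by $X$. The $S$-degree of $X$ is the maximal number (possibly infinite) of parses with respect to $X$ of a word of $S$. Let $X\subseteq S$ be a finite $S$-maximal bifix code of $S$-degree $d$, and let $w\in S$ be a nonempty word. Put $$G=Xw^{-1}=\{v\in A^*\mid vw\in X\},\qquad D=w^{-1}X=\{v\in A^*\mid wv\in X\},$$ $$G_0=(wD)w^{-1},\quad D_0=w^{-1}(Gw),\quad G_1=G\setminus G_0,\quad D_1=D\setminus D_0 .$$ If $G_1$ and $D_1$ are nonempty, then the set $$Y=\bigl(X\cup\{w\}\cup(G_1wD_0^*D_1\cap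 S)\bigr)\setminus(Gw\cup wD)$$ is a finite $S$-maximal bifix code of $S$-degree at most $d$. -/

import Mathlib

open scoped Computability

namespace BifixCode

variable {A : Type*}

/-- A set of words is factorial if it contains the factors of its elements. -/
def IsFactorial (S : Language A) : Prop :=
  ∀ w ∈ S, ∀ u : List A, u <:+: w → u ∈ S

/-- Every word of `S` can be extended on the right by a letter inside `S`. -/
def IsRightExtendable (S : Language A) : Prop :=
  ∀ w ∈ S, ∃ a : A, w ++ [a] ∈ S

/-- Uniformly recurrent set of words: factorial, right-extendable, and each word of `S` is a
factor of every word of `S` of some fixed length `n ≥ 1`. -/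
structure IsUniformlyRecurrent (S : Language A) : Prop where
  factorial : IsFactorial S
  rightExtendable : IsRightExtendable S
  recurrent : ∀ u ∈ S, ∃ n : ℕ, 1 ≤ n ∧ ∀ w ∈ S, w.length = n → u <:+: w

/-- A set of nonempty words containing no proper prefix of its elements. -/
def IsPrefixCode (X : Language A) : Prop :=
  [] ∉ X ∧ ∀ x ∈ X, ∀ y ∈ X, x <+: y → x = y

/-- A set of nonempty words containing no proper suffix of its elements. -/
def IsSuffixCode (X : Language A) : Prop :=
  [] ∉ X ∧ ∀ x ∈ X, ∀ y ∈ X, x <:+ y → x = y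

/-- A set of words that is both a prefix code and a suffix code. -/
def IsBifixCode (X : Language A) : Prop :=
  IsPrefixCode X ∧ IsSuffixCode X

/-- `X ⊆ S` is a bifix code not properly contained in any bifix code `Y ⊆ S`. -/
def IsMaximalBifixCode (S X : Language A) : Prop :=
  Maximal (fun Y : Language A => IsBifixCode Y ∧ Y ≤ S) X

/-- The parses of `w` with respect to `X`: triples `(v, x, u)` with `w = v x u`, where `v` has no
suffix in `X`, `u` has no prefix in `X`, and `x` lies in the submonoid `X∗`. -/
def parses (X : Language A) (w : List A) : Set (List A × List A × List A) :=
  {p | w = p.1 ++ p.2.1 ++ p.2.2 ∧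
    (∀ s : List A, s <:+ p.1 → s ∉ X) ∧ p.2.1 ∈ X∗ ∧ (∀ s : List A, s <+: p.2.2 → s ∉ X)}

/-- The number of parses of `w` with respect to `X`. -/
noncomputable def numParses (X : Language A) (w : List A) : ℕ∞ :=
  (parses X w).encard

/-- The `S`-degree of `X`: the maximal number of parses of a word of `S`, possibly infinite. -/
noncomputable def degree (S X : Language A) : ℕ∞ :=
  ⨆ w ∈ S, numParses X w

/-- The left residual `w⁻¹X = {v | wv ∈ X}`. -/
def leftResidual (w : List A) (X : Language A) : Language A :=
  {v : List A | w ++ v ∈ X}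

/-- The right residual `Xw⁻¹ = {v | vw ∈ X}`. -/
def rightResidual (X : Language A) (w : List A) : Language A :=
  {v : List A | v ++ w ∈ X}

/-- `G = Xw⁻¹`. -/
def setG (X : Language A) (w : List A) : Language A := rightResidual X w

/-- `D = w⁻¹X`. -/
def setD (X : Language A) (w : List A) : Language A := leftResidual w X

/-- `G₀ = (wD)w⁻¹`. -/
def setG₀ (X : Language A) (w : List A) : Language A := rightResidual ({w} * setD X w) w

/-- `D₀ = w⁻¹(Gw)`. -/
def setD₀ (X : Language A) (w : List A) : Language A := leftResidual w (setG X w * {w})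

/-- `G₁ = G \ G₀`. -/
def setG₁ (X : Language A) (w : List A) : Language A := setG X w \ setG₀ X w

/-- `D₁ = D \ D₀`. -/
def setD₁ (X : Language A) (w : List A) : Language A := setD X w \ setD₀ X w

/-- The (generalized) internal transformation of `X` with respect to `w`, inside `S`:
`(X ∪ {w} ∪ (G₁ w D₀∗ D₁ ∩ S)) \ (Gw ∪ wD)`. -/
def internalTransformation (S X : Language A) (w : List A) : Language A :=
  (X ⊔ {w} ⊔ ((setG₁ X w * {w} * (setD₀ X w)∗ * setD₁ X w) ⊓ S)) \
    ((setG X w * {w}) ⊔ ({w} * setD X w))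

end BifixCode

/-!
The proof is a parse-counting argument, and needs no embedding of `X` into a maximal bifix code
of the free monoid.

For a prefix code `X`, a parse of `s` is determined by its first component, so the number of parses
of `s` is the number of prefixes of `s` without a suffix in `X` (`numParses_eq_encard`). From this
description come three facts about a recurrent set `S`. A finite `S`-maximal bifix code has finite
degree (`IsMaximalBifixCode.degree_lt_top`): otherwise there are a long word `u` with no prefix in
`X` and a long word `v` with no suffix in `X`, and a word `u t v` of `S` could be added to `X`.
Conversely, a bifix code `Y ⊆ S` of finite degree is `S`-maximal
(`isMaximalBifixCode_of_degree_lt_top`): if `z` could be added, the words `z t z t' z ⋯` of `S` would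
have arbitrarily many parses. If `S` is uniformly recurrent, `Y` is moreover finite
(`finite_of_degree_lt_top`), since a word with the maximal number of parses cannot occur strictly
inside a word of `Y`.

It remains to see that the transformed set `Y` is a bifix code and that no word of `S` has more
parses with respect to `Y` than with respect to `X`. For the latter
(`encard_suffixFreePrefixes_internalTransformation_le`), the words of `S` with a suffix in `X` but none in
`Y` have the form `q w d₁ ⋯ dₙ e` with `dᵢ ∈ D₀`, `e ∈ D₁`, where `q w` has no suffix in `X`; sending
such a word to `q w`, which has the suffix `w ∈ Y`, is injective on the prefixes of a fixed word,
because `D₀∗D₁` is a prefix code.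
-/

namespace BifixCode

/-! ### Prefix codes, suffix codes and reversal -/

theorem IsPrefixCode.eq_of_append_prefix {A : Type*} {X : Language A} (hX : IsPrefixCode X)
    {x y r t : List A} (hx : x ∈ X) (hy : y ∈ X) (h : x ++ r <+: y ++ t) : x = y := by
  rcases List.prefix_or_prefix_of_prefix ((List.prefix_append x r).trans h)
    (List.prefix_append y t) with h' | h'
  · exact hX.2 x hx y hy h'
  · exact (hX.2 y hy x hx h').symm

theorem IsPrefixCode.eq_of_prefix_prefix {A : Type*} {X : Language A} (hX : IsPrefixCode X)
    {x y s : List A} (hx : x ∈ X) (hy : y ∈ X) (h : x <+: s) (h' : y <+: s) : x = y := by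
  rcases List.prefix_or_prefix_of_prefix h h' with h | h
  · exact hX.2 x hx y hy h
  · exact (hX.2 y hy x hx h).symm

theorem IsSuffixCode.eq_of_suffix_suffix {A : Type*} {X : Language A} (hX : IsSuffixCode X)
    {x y s : List A} (hx : x ∈ X) (hy : y ∈ X) (h : x <:+ s) (h' : y <:+ s) : x = y := by
  rcases List.suffix_or_suffix_of_suffix h h' with h | h
  · exact hX.2 x hx y hy h
  · exact (hX.2 y hy x hx h).symm

theorem isPrefixCode_reverse {A : Type*} {X : Language A} :
    IsPrefixCode X.reverse ↔ IsSuffixCode X := by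
  constructor
  · rintro ⟨h₀, h⟩
    refine ⟨fun h' => h₀ (by simpa using h'), fun x hx y hy hxy => ?_⟩
    exact List.reverse_injective (h x.reverse (by simpa using hx) y.reverse (by simpa using hy)
      (by simpa using hxy))
  · rintro ⟨h₀, h⟩
    refine ⟨fun h' => h₀ (by simpa using h'), fun x hx y hy hxy => ?_⟩
    exact List.reverse_injective (h x.reverse hx y.reverse hy (by simpa using hxy))

theorem isSuffixCode_reverse {A : Type*} {X : Language A} :
    IsSuffixCode X.reverse ↔ IsPrefixCode X := by
  rw [← isPrefixCode_reverse, Language.reverse_reverse]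

theorem IsBifixCode.reverse {A : Type*} {X : Language A} (hX : IsBifixCode X) :
    IsBifixCode X.reverse :=
  ⟨isPrefixCode_reverse.2 hX.2, isSuffixCode_reverse.2 hX.1⟩

/-- If `D₀` and `D₁` are disjoint subsets of a prefix code, then `D₀∗D₁` is a prefix code. -/
theorem IsPrefixCode.eq_of_flatten_append_prefix {A : Type*} {D D₀ D₁ : Language A}
    (hD : IsPrefixCode D) (h₀ : ∀ x ∈ D₀, x ∈ D) (h₁ : ∀ x ∈ D₁, x ∈ D)
    (hdisj : ∀ x ∈ D₀, x ∉ D₁) {e f : List A} (he : e ∈ D₁) (hf : f ∈ D₁) :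
    ∀ L M : List (List A), (∀ x ∈ L, x ∈ D₀) → (∀ x ∈ M, x ∈ D₀) →
      L.flatten ++ e <+: M.flatten ++ f → L.flatten ++ e = M.flatten ++ f
  | [], [], _, _, h => by
    simp only [List.flatten_nil, List.nil_append] at h ⊢
    exact hD.2 e (h₁ e he) f (h₁ f hf) h
  | [], m :: M, _, hM, h => by
    have hm := hM m (by simp)
    have : e = m := hD.eq_of_append_prefix (r := []) (t := M.flatten ++ f) (h₁ e he) (h₀ m hm)
      (by simpa using h)
    exact absurd (this ▸ he) (hdisj m hm)
  | l :: L, [], hL, _, h => by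
    have hl := hL l (by simp)
    have : l = f := hD.eq_of_append_prefix (r := L.flatten ++ e) (t := []) (h₀ l hl) (h₁ f hf)
      (by simpa using h)
    exact absurd (this ▸ hf) (hdisj l hl)
  | l :: L, m :: M, hL, hM, h => by
    have hl := hL l (by simp)
    have hm := hM m (by simp)
    simp only [List.flatten_cons, List.append_assoc] at h ⊢
    obtain rfl : l = m := hD.eq_of_append_prefix (h₀ l hl) (h₀ m hm) h
    rw [List.prefix_append_right_inj] at h
    rw [hD.eq_of_flatten_append_prefix h₀ h₁ hdisj he hf L M
      (fun x hx => hL x (by simp [hx])) (fun x hx => hM x (by simp [hx])) h]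

/-! ### Counting parses -/

/-- The prefixes of `s` that have no suffix in `X`. -/
def suffixFreePrefixes {A : Type*} (X : Language A) (s : List A) : Set (List A) :=
  {p | p <+: s ∧ ∀ t : List A, t <:+ p → t ∉ X}

theorem finite_suffixFreePrefixes {A : Type*} (X : Language A) (s : List A) :
    (suffixFreePrefixes X s).Finite :=
  (List.finite_toSet s.inits).subset fun _ hp => (List.mem_inits _ _).2 hp.1

theorem suffixFreePrefixes_mono {A : Type*} (X : Language A) {s t : List A} (h : s <+: t) :
    suffixFreePrefixes X s ⊆ suffixFreePrefixes X t :=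
  fun _ hp => ⟨hp.1.trans h, hp.2⟩

/-- The factorization comes from removing words of `X` from the left end of `r` as long as
possible. -/
theorem exists_kstar_append_of_nil_notMem {A : Type*} {X : Language A} (hX : [] ∉ X)
    (r : List A) : ∃ x ∈ X∗, ∃ u, r = x ++ u ∧ ∀ t : List A, t <+: u → t ∉ X := by
  induction hn : r.length using Nat.strong_induction_on generalizing r with
  | _ n ih =>
    by_cases h : ∀ t : List A, t <+: r → t ∉ X
    · exact ⟨[], Language.nil_mem_kstar X, r, rfl, h⟩
    · push Not at h
      obtain ⟨t, ⟨r', rfl⟩, htX⟩ := h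
      have ht : t ≠ [] := fun h0 => hX (h0 ▸ htX)
      have := List.length_pos_iff.2 ht
      obtain ⟨x, hx, u, rfl, hu⟩ := ih r'.length (by simp at hn; omega) r' rfl
      refine ⟨t ++ x, ?_, u, by simp, hu⟩
      obtain ⟨L, rfl, hL⟩ := hx
      exact ⟨t :: L, by simp, by simpa using ⟨htX, hL⟩⟩

/-- The factorization of a word into an element of `X∗` and a word without a prefix in `X` is unique
when `X` is a prefix code. -/
theorem IsPrefixCode.flatten_unique {A : Type*} {X : Language A} (hX : IsPrefixCode X)
    {u v : List A} (hu : ∀ t : List A, t <+: u → t ∉ X) (hv : ∀ t : List A, t <+: v → t ∉ X) :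
    ∀ L M : List (List A), (∀ x ∈ L, x ∈ X) → (∀ x ∈ M, x ∈ X) →
      L.flatten ++ u = M.flatten ++ v → L.flatten = M.flatten
  | [], [], _, _, _ => rfl
  | [], m :: M, _, hM, h =>
    absurd (hM m (by simp)) (hu m ⟨M.flatten ++ v, by simpa using h.symm⟩)
  | l :: L, [], hL, _, h =>
    absurd (hL l (by simp)) (hv l ⟨L.flatten ++ u, by simpa using h⟩)
  | l :: L, m :: M, hL, hM, h => by
    simp only [List.flatten_cons, List.append_assoc] at h ⊢
    obtain rfl : l = m := hX.eq_of_append_prefix (hL l (by simp)) (hM m (by simp))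
      ⟨[], by rw [List.append_nil]; exact h⟩
    rw [hX.flatten_unique hu hv L M (fun x hx => hL x (by simp [hx]))
      (fun x hx => hM x (by simp [hx])) (List.append_cancel_left h)]

/-- For a prefix code, a parse is determined by its first component, which may be any prefix
without a suffix in the code. -/
theorem numParses_eq_encard {A : Type*} {X : Language A} (hX : IsPrefixCode X) (s : List A) :
    numParses X s = (suffixFreePrefixes X s).encard := by
  have himage : Prod.fst '' parses X s = suffixFreePrefixes X s := by
    ext v
    constructor
    · rintro ⟨⟨v, x, u⟩, ⟨h, hv, -, -⟩, rfl⟩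
      exact ⟨⟨x ++ u, by simpa using h.symm⟩, hv⟩
    · rintro ⟨⟨r, rfl⟩, hv⟩
      obtain ⟨x, hx, u, rfl, hu⟩ := exists_kstar_append_of_nil_notMem hX.1 r
      exact ⟨(v, x, u), ⟨by simp, hv, hx, hu⟩, rfl⟩
  rw [← himage, Set.InjOn.encard_image, numParses]
  rintro ⟨v, x, u⟩ ⟨h, -, ⟨L, rfl, hL⟩, hu⟩ ⟨v', x', u'⟩ ⟨h', -, ⟨M, rfl, hM⟩, hu'⟩ rfl
  have heq : L.flatten ++ u = M.flatten ++ u' := by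
    simpa using h.symm.trans h'
  have hLM := hX.flatten_unique hu hu' L M hL hM heq
  rw [hLM] at heq ⊢
  rw [List.append_cancel_left heq]

theorem numParses_reverse {A : Type*} (X : Language A) (s : List A) :
    numParses X.reverse s.reverse = numParses X s := by
  have himage : (fun p : List A × List A × List A => (p.2.2.reverse, p.2.1.reverse, p.1.reverse)) ''
      parses X s = parses X.reverse s.reverse := by
    ext ⟨v, x, u⟩
    constructor
    · rintro ⟨⟨v', x', u'⟩, ⟨h, hv, hx, hu⟩, heq⟩
      simp only [Prod.mk.injEq] at heq h hv hx hu
      obtain ⟨rfl, rfl, rfl⟩ := heq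
      refine ⟨by simp [h], fun t ht => hu _ ?_, ?_, fun t ht => hv _ ?_⟩
      · rw [← List.reverse_suffix]; simpa using ht
      · rw [← Language.reverse_kstar]; exact Language.reverse_mem_reverse.2 hx
      · rw [← List.reverse_prefix]; simpa using ht
    · rintro ⟨h, hv, hx, hu⟩
      simp only at h hv hx hu
      refine ⟨(u.reverse, x.reverse, v.reverse), ⟨?_, fun t ht => ?_, ?_, fun t ht => ?_⟩, by simp⟩
      · rw [← List.reverse_reverse s, h]; simp
      · have := hu t.reverse (by rw [← List.reverse_suffix]; simpa using ht)
        simpa using this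
      · rw [← Language.reverse_kstar] at hx; exact hx
      · have := hv t.reverse (by rw [← List.reverse_prefix]; simpa using ht)
        simpa using this
  rw [numParses, ← himage, Set.InjOn.encard_image, numParses]
  rintro ⟨v, x, u⟩ - ⟨v', x', u'⟩ - h
  simp only [Prod.mk.injEq, List.reverse_inj] at h
  simp [h.1, h.2.1, h.2.2]

theorem encard_suffixFreePrefixes_le {A : Type*} {X : Language A} {s : List A} {M : ℕ}
    (h : ∀ p ∈ suffixFreePrefixes X s, p.length ≤ M) :
    (suffixFreePrefixes X s).encard ≤ M + 1 := by
  have := Set.encard_le_encard_of_injOn (s := suffixFreePrefixes X s) (t := Finset.range (M + 1))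
    (f := List.length) (fun p hp => by simpa using Nat.lt_succ_of_le (h p hp))
    (fun p hp q hq hpq => (List.prefix_of_prefix_length_le hp.1 hq.1 hpq.le).eq_of_length hpq)
  rwa [Set.encard_coe_eq_coe_finsetCard, Finset.card_range, Nat.cast_succ] at this

/-! ### Recurrence, maximality and finite degree -/

theorem IsUniformlyRecurrent.exists_append_mem {A : Type*} {S : Language A}
    (hS : IsUniformlyRecurrent S) {u : List A} (hu : u ∈ S) (n : ℕ) :
    ∃ t : List A, t.length = n ∧ u ++ t ∈ S := by
  induction n with
  | zero => exact ⟨[], rfl, by simpa using hu⟩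
  | succ n ih =>
    obtain ⟨t, ht, h⟩ := ih
    obtain ⟨a, ha⟩ := hS.rightExtendable _ h
    exact ⟨t ++ [a], by simp [ht], by simpa using ha⟩

theorem IsUniformlyRecurrent.exists_append_append_mem {A : Type*} {S : Language A}
    (hS : IsUniformlyRecurrent S) {u v : List A} (hu : u ∈ S) (hv : v ∈ S) :
    ∃ t : List A, u ++ t ++ v ∈ S := by
  obtain ⟨n, -, hn⟩ := hS.recurrent v hv
  obtain ⟨r, hr, hur⟩ := hS.exists_append_mem hu n
  obtain ⟨a, b, rfl⟩ := hn r (hS.factorial _ hur r (List.suffix_append u r).isInfix) hr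
  exact ⟨a, hS.factorial _ hur _ (List.IsPrefix.isInfix ⟨b, by simp⟩)⟩

/-- No word of `S` can be both prefix-incomparable and suffix-incomparable with all words of an
`S`-maximal bifix code, for it could be added to the code. -/
theorem IsMaximalBifixCode.not_incomparable {A : Type*} {S X : Language A}
    (hX : IsMaximalBifixCode S X) {z : List A} (hzS : z ∈ S) (hz : z ≠ [])
    (hp : ∀ x ∈ X, ¬ x <+: z ∧ ¬ z <+: x) (hs : ∀ x ∈ X, ¬ x <:+ z ∧ ¬ z <:+ x) : False := by
  have hbif : IsBifixCode (X ⊔ {z}) := by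
    refine ⟨⟨?_, ?_⟩, ⟨?_, ?_⟩⟩
    · rintro (h | h)
      · exact hX.1.1.1.1 h
      · exact hz h.symm
    · rintro x (hx | rfl) y (hy | rfl) h
      · exact hX.1.1.1.2 x hx y hy h
      · exact absurd h (hp x hx).1
      · exact absurd h (hp y hy).2
      · rfl
    · rintro (h | h)
      · exact hX.1.1.1.1 h
      · exact hz h.symm
    · rintro x (hx | rfl) y (hy | rfl) h
      · exact hX.1.1.2.2 x hx y hy h
      · exact absurd h (hs x hx).1
      · exact absurd h (hs y hy).2
      · rfl
  have hle : X ⊔ {z} ≤ S := by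
    rintro x (hx | rfl)
    · exact hX.1.2 hx
    · exact hzS
  have hzX : z ∈ X := hX.2 ⟨hbif, hle⟩ le_sup_left (Or.inr rfl)
  exact (hp z hzX).1 List.prefix_rfl

theorem IsMaximalBifixCode.degree_lt_top {A : Type*} {S X : Language A}
    (hS : IsUniformlyRecurrent S) (hX : IsMaximalBifixCode S X)
    (hfin : Set.Finite {x : List A | x ∈ X}) : degree S X < ⊤ := by
  obtain ⟨M, hM⟩ : ∃ M, ∀ x ∈ X, x.length ≤ M := by
    obtain ⟨M, hM⟩ := (hfin.image List.length).bddAbove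
    exact ⟨M, fun x hx => hM ⟨x, hx, rfl⟩⟩
  suffices h : degree S X ≤ M + 1 from h.trans_lt (by exact_mod_cast ENat.natCast_lt_top (M + 1))
  refine iSup₂_le fun s hs => ?_
  by_cases hsuf : ∀ v ∈ S, (∀ t : List A, t <:+ v → t ∉ X) → v.length ≤ M
  · rw [numParses_eq_encard hX.1.1.1]
    exact encard_suffixFreePrefixes_le fun p hp =>
      hsuf p (hS.factorial s hs p hp.1.isInfix) hp.2
  by_cases hpre : ∀ u ∈ S, (∀ t : List A, t <+: u → t ∉ X) → u.length ≤ M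
  · rw [← numParses_reverse, numParses_eq_encard hX.1.1.reverse.1]
    refine encard_suffixFreePrefixes_le fun p hp => ?_
    have hp1 : p.reverse <:+ s := by rw [← List.reverse_prefix]; simpa using hp.1
    rw [← List.length_reverse]
    refine hpre p.reverse (hS.factorial s hs _ hp1.isInfix) fun t ht htX => ?_
    refine hp.2 t.reverse ?_ (by simpa using htX)
    rw [← List.reverse_prefix]; simpa using ht
  push Not at hsuf hpre
  obtain ⟨v, hv, hvX, hvM⟩ := hsuf
  obtain ⟨u, hu, huX, huM⟩ := hpre
  obtain ⟨t, ht⟩ := hS.exists_append_append_mem hu hv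
  refine (hX.not_incomparable ht ?_ (fun x hx => ⟨fun h => ?_, fun h => ?_⟩)
    (fun x hx => ⟨fun h => ?_, fun h => ?_⟩)).elim
  · intro h
    simp only [List.append_eq_nil_iff] at h
    simp [h.2] at hvM
  · exact huX x (List.prefix_of_prefix_length_le h ⟨t ++ v, by simp⟩
      ((hM x hx).trans huM.le)) hx
  · have := h.length_le
    have := hM x hx
    simp only [List.length_append] at *
    omega
  · exact hvX x (List.suffix_of_suffix_length_le h (List.suffix_append _ _)
      ((hM x hx).trans hvM.le)) hx
  · have := h.length_le
    have := hM x hx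
    simp only [List.length_append] at *
    omega

theorem isMaximalBifixCode_of_degree_lt_top {A : Type*} {S Y : Language A}
    (hS : IsUniformlyRecurrent S) (hY : IsBifixCode Y) (hYS : Y ≤ S)
    (hdeg : degree S Y < ⊤) : IsMaximalBifixCode S Y := by
  refine ⟨⟨hY, hYS⟩, fun Z hZ hYZ z hz => ?_⟩
  by_contra hzY
  have hz0 : 0 < z.length := List.length_pos_iff.2 fun h => hZ.1.1.1 (h ▸ hz)
  -- Every word ending with `z` has no suffix in `Y`, so each new occurrence of `z` adds a parse.
  have key : ∀ k : ℕ, ∃ s ∈ S, (k : ℕ∞) ≤ (suffixFreePrefixes Y s).encard := by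
    intro k
    induction k with
    | zero => exact ⟨z, hZ.2 hz, by simp⟩
    | succ k ih =>
      obtain ⟨s, hs, hk⟩ := ih
      obtain ⟨t, ht⟩ := hS.exists_append_append_mem hs (hZ.2 hz)
      refine ⟨s ++ t ++ z, ht, ?_⟩
      have hnot : s ++ t ++ z ∉ suffixFreePrefixes Y s := fun h => by
        have := h.1.length_le
        simp only [List.length_append] at this
        omega
      have hsub : insert (s ++ t ++ z) (suffixFreePrefixes Y s) ⊆
          suffixFreePrefixes Y (s ++ t ++ z) := by
        refine Set.insert_subset ⟨List.prefix_rfl, fun y hy hyY => ?_⟩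
          (suffixFreePrefixes_mono Y ⟨t ++ z, by simp⟩)
        have := hZ.1.2.eq_of_suffix_suffix (hYZ hyY) hz hy (List.suffix_append _ _)
        exact hzY (this ▸ hyY)
      refine le_trans ?_ (Set.encard_le_encard hsub)
      rw [Set.encard_insert_of_notMem hnot]
      push_cast
      gcongr
  obtain ⟨n, hn⟩ := ENat.ne_top_iff_exists.1 hdeg.ne
  obtain ⟨s, hs, hk⟩ := key (n + 1)
  have h1 : numParses Y s ≤ degree S Y := le_iSup₂_of_le s hs le_rfl
  rw [numParses_eq_encard hY.1, ← hn] at h1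
  have := hk.trans h1
  norm_cast at this
  omega

theorem exists_forall_numParses_le {A : Type*} {S Y : Language A} (hne : ∃ s, s ∈ S)
    (hdeg : degree S Y < ⊤) : ∃ s ∈ S, ∀ t ∈ S, numParses Y t ≤ numParses Y s := by
  obtain ⟨n, hn⟩ := ENat.ne_top_iff_exists.1 hdeg.ne
  have hle : ∀ t ∈ S, numParses Y t ≤ n := fun t ht => hn ▸ le_iSup₂_of_le t ht le_rfl
  have hfin : ((numParses Y) '' {s | s ∈ S}).Finite :=
    (Set.finite_le_nat n).image (fun k : ℕ => (k : ℕ∞)) |>.subset (by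
      rintro _ ⟨t, ht, rfl⟩
      obtain ⟨k, hk, hkn⟩ := ENat.le_natCast_iff.1 (hle t ht)
      exact ⟨k, hkn, hk.symm⟩)
  obtain ⟨_, ⟨s, hs, rfl⟩, hmax⟩ := Set.exists_max_image _ id hfin (hne.elim fun s hs => ⟨_, s, hs, rfl⟩)
  exact ⟨s, hs, fun t ht => hmax _ ⟨t, ht, rfl⟩⟩

/-- In a uniformly recurrent set, a bifix code of finite degree is finite: a word `s` with the
maximal number of parses cannot occur strictly inside a word `p s q` of the code, as the word `s q`
would have more parses. -/
theorem finite_of_degree_lt_top {A : Type*} [Finite A] {S Y : Language A}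
    (hS : IsUniformlyRecurrent S) (hne : ∃ s, s ∈ S) (hY : IsBifixCode Y) (hYS : Y ≤ S)
    (hdeg : degree S Y < ⊤) : Set.Finite {y : List A | y ∈ Y} := by
  obtain ⟨s, hs, hmax⟩ := exists_forall_numParses_le hne hdeg
  obtain ⟨n, -, hn⟩ := hS.recurrent s hs
  -- Without its first and its last letter, a word of length at least `n + 2` still has a factor of
  -- length `n`, hence an occurrence of `s`.
  refine (List.finite_length_le A (n + 1)).subset fun y hy => ?_
  by_contra hlen
  simp only [Set.mem_ofPred_eq, not_le] at hlen hy
  have hyeq : y = y.take 1 ++ ((y.drop 1).take n ++ (y.drop 1).drop n) := by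
    rw [List.take_append_drop, List.take_append_drop]
  have hr : (y.drop 1).take n ∈ S := hS.factorial y (hYS hy) _
    ((List.take_prefix _ _).isInfix.trans (List.drop_suffix _ _).isInfix)
  obtain ⟨a, b, hab⟩ := hn _ hr (by simp; omega)
  obtain ⟨p, hp⟩ : ∃ p, p = y.take 1 ++ a := ⟨_, rfl⟩
  obtain ⟨q, hq⟩ : ∃ q, q = b ++ (y.drop 1).drop n := ⟨_, rfl⟩
  have hpsq : y = p ++ (s ++ q) := by rw [hyeq, ← hab, hp, hq]; simp
  have hp0 : 0 < p.length := by rw [hp]; simp; omega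
  have hq0 : 0 < q.length := by rw [hq]; simp; omega
  have hsq : s ++ q <:+ y := ⟨p, hpsq.symm⟩
  have hsqS : s ++ q ∈ S := hS.factorial y (hYS hy) _ hsq.isInfix
  have hnot : s ++ q ∉ suffixFreePrefixes Y s := fun h => by
    have := h.1.length_le
    rw [List.length_append] at this
    omega
  have hsub : insert (s ++ q) (suffixFreePrefixes Y s) ⊆ suffixFreePrefixes Y (s ++ q) := by
    refine Set.insert_subset ⟨List.prefix_rfl, fun t ht htY => ?_⟩
      (suffixFreePrefixes_mono Y (List.prefix_append s q))
    have h1 := hY.2.2 t htY y hy (ht.trans hsq)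
    have h2 := ht.length_le
    rw [h1, hpsq] at h2
    simp only [List.length_append] at h2
    omega
  have h := (Set.encard_le_encard hsub).trans
    ((numParses_eq_encard hY.1 (s ++ q)).symm.le.trans (hmax _ hsqS))
  rw [numParses_eq_encard hY.1, Set.encard_insert_of_notMem hnot] at h
  exact absurd h (not_le.2 (ENat.lt_add_one_iff'
    (finite_suffixFreePrefixes Y s).encard_lt_top.ne |>.2 le_rfl))

/-! ### The internal transformation -/

theorem mem_setG₀ {A : Type*} {X : Language A} {w g : List A} :
    g ∈ setG₀ X w ↔ g ++ w ∈ X ∧ w <+: g ++ w := by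
  change g ++ w ∈ ({w} : Language A) * setD X w ↔ _
  rw [Language.mem_mul]
  constructor
  · rintro ⟨_, rfl, d, hd, h⟩
    exact ⟨h ▸ hd, ⟨d, h⟩⟩
  · rintro ⟨hX, d, h⟩
    exact ⟨w, rfl, d, show w ++ d ∈ X from h ▸ hX, h⟩

theorem mem_setD₀ {A : Type*} {X : Language A} {w d : List A} :
    d ∈ setD₀ X w ↔ w ++ d ∈ X ∧ w <:+ w ++ d := by
  change w ++ d ∈ setG X w * ({w} : Language A) ↔ _
  rw [Language.mem_mul]
  constructor
  · rintro ⟨g, hg, _, rfl, h⟩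
    exact ⟨h ▸ hg, ⟨g, h⟩⟩
  · rintro ⟨hX, g, h⟩
    exact ⟨g, show g ++ w ∈ X from h ▸ hX, w, rfl, h⟩

theorem mem_setG₁ {A : Type*} {X : Language A} {w g : List A} :
    g ∈ setG₁ X w ↔ g ++ w ∈ X ∧ ¬ w <+: g ++ w := by
  change g ++ w ∈ X ∧ ¬ g ∈ setG₀ X w ↔ _
  rw [mem_setG₀]
  tauto

theorem mem_setD₁ {A : Type*} {X : Language A} {w d : List A} :
    d ∈ setD₁ X w ↔ w ++ d ∈ X ∧ ¬ w <:+ w ++ d := by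
  change w ++ d ∈ X ∧ ¬ d ∈ setD₀ X w ↔ _
  rw [mem_setD₀]
  tauto

theorem mem_internalTransformation {A : Type*} {S X : Language A} {w y : List A} :
    y ∈ internalTransformation S X w ↔
      ((y ∈ X ∨ y = w) ∨ y ∈ setG₁ X w * {w} * (setD₀ X w)∗ * setD₁ X w ∧ y ∈ S) ∧
        ¬ (y ∈ X ∧ (w <:+ y ∨ w <+: y)) := by
  have h1 : y ∈ setG X w * {w} ↔ y ∈ X ∧ w <:+ y := by
    rw [Language.mem_mul]
    constructor
    · rintro ⟨g, hg, _, rfl, rfl⟩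
      exact ⟨hg, g, rfl⟩
    · rintro ⟨hX, g, rfl⟩
      exact ⟨g, hX, w, rfl, rfl⟩
  have h2 : y ∈ ({w} : Language A) * setD X w ↔ y ∈ X ∧ w <+: y := by
    rw [Language.mem_mul]
    constructor
    · rintro ⟨_, rfl, d, hd, rfl⟩
      exact ⟨hd, d, rfl⟩
    · rintro ⟨hX, d, rfl⟩
      exact ⟨w, rfl, d, hX, rfl⟩
  rw [and_or_left, ← h1, ← h2]
  exact Iff.rfl

theorem mem_setG₁_mul_kstar_mul_setD₁ {A : Type*} {X : Language A} {w y : List A} :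
    y ∈ setG₁ X w * {w} * (setD₀ X w)∗ * setD₁ X w ↔
      ∃ g ∈ setG₁ X w, ∃ L : List (List A), (∀ x ∈ L, x ∈ setD₀ X w) ∧
        ∃ e ∈ setD₁ X w, g ++ (w ++ (L.flatten ++ e)) = y := by
  simp only [Language.mem_mul, Language.mem_kstar]
  constructor
  · rintro ⟨_, ⟨_, ⟨g, hg, _, rfl, rfl⟩, _, ⟨L, rfl, hL⟩, rfl⟩, e, he, rfl⟩
    exact ⟨g, hg, L, hL, e, he, by simp⟩
  · rintro ⟨g, hg, L, hL, e, he, rfl⟩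
    exact ⟨_, ⟨_, ⟨g, hg, w, rfl, rfl⟩, _, ⟨L, rfl, hL⟩, rfl⟩, e, he, by simp⟩

/-- Since `wD₀ = G₀w`, also `wD₀∗ = G₀∗w`; this makes the definition of the internal
transformation left-right symmetric. -/
theorem singleton_mul_setD₀_kstar {A : Type*} (X : Language A) (w : List A) :
    ({w} : Language A) * (setD₀ X w)∗ = (setG₀ X w)∗ * {w} := by
  have h : SemiconjBy ({w} : Language A) (setD₀ X w) (setG₀ X w) := by
    apply Language.ext
    intro y
    rw [Language.mem_mul, Language.mem_mul]
    constructor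
    · rintro ⟨_, rfl, d, hd, rfl⟩
      obtain ⟨hX, g, hg⟩ := mem_setD₀.1 hd
      exact ⟨g, mem_setG₀.2 ⟨hg ▸ hX, d, hg.symm⟩, _, rfl, hg⟩
    · rintro ⟨g, hg, _, rfl, rfl⟩
      obtain ⟨hX, d, hd⟩ := mem_setG₀.1 hg
      exact ⟨_, rfl, d, mem_setD₀.2 ⟨hd ▸ hX, g, hd.symm⟩, hd⟩
  rw [Language.kstar_eq_iSup_pow, Language.kstar_eq_iSup_pow, Language.mul_iSup, Language.iSup_mul]
  exact iSup_congr fun n => h.pow_right n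

theorem reverse_setG₁_mul_kstar_mul_setD₁ {A : Type*} (X : Language A) (w : List A) :
    (setG₁ X w * {w} * (setD₀ X w)∗ * setD₁ X w).reverse =
      setG₁ X.reverse w.reverse * {w.reverse} * (setD₀ X.reverse w.reverse)∗ *
        setD₁ X.reverse w.reverse := by
  have hw : ({w} : Language A).reverse = {w.reverse} := by
    apply Language.ext
    intro y
    change y.reverse = w ↔ y = w.reverse
    rw [List.reverse_eq_iff]
  have hG₁ : (setG₁ X w).reverse = setD₁ X.reverse w.reverse := by
    apply Language.ext
    intro y
    rw [Language.mem_reverse, mem_setG₁, mem_setD₁, ← List.reverse_suffix]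
    simp
  have hD₁ : (setD₁ X w).reverse = setG₁ X.reverse w.reverse := by
    apply Language.ext
    intro y
    rw [Language.mem_reverse, mem_setG₁, mem_setD₁, ← List.reverse_prefix]
    simp
  have hG₀ : (setG₀ X w).reverse = setD₀ X.reverse w.reverse := by
    apply Language.ext
    intro y
    rw [Language.mem_reverse, mem_setG₀, mem_setD₀, ← List.reverse_suffix]
    simp
  rw [mul_assoc (setG₁ X w), singleton_mul_setD₀_kstar]
  simp only [Language.reverse_mul, Language.reverse_kstar, hw, hG₁, hD₁, hG₀, mul_assoc]

theorem reverse_internalTransformation {A : Type*} (S X : Language A) (w : List A) :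
    (internalTransformation S X w).reverse =
      internalTransformation S.reverse X.reverse w.reverse := by
  apply Language.ext
  intro y
  rw [Language.mem_reverse, mem_internalTransformation, mem_internalTransformation,
    ← reverse_setG₁_mul_kstar_mul_setD₁, Language.mem_reverse, Language.mem_reverse, Language.mem_reverse,
    List.reverse_eq_iff, ← List.reverse_prefix (l₁ := w), ← List.reverse_suffix (l₁ := w),
    List.reverse_reverse, or_comm (a := w.reverse <:+ y)]

theorem isPrefixCode_setD {A : Type*} {X : Language A} (hX : IsPrefixCode X) {w : List A}
    (hwX : w ∉ X) : IsPrefixCode (setD X w) := by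
  refine ⟨fun h => hwX ?_, fun x hx y hy h => ?_⟩
  · have : w ++ [] ∈ X := h
    simpa using this
  · exact List.append_cancel_left (hX.2 (w ++ x) hx (w ++ y) hy
      ((List.prefix_append_right_inj w).2 h))

/-- The instance of `IsPrefixCode.eq_of_flatten_append_prefix` for the sets `D₀, D₁ ⊆ D`. -/
theorem eq_of_flatten_append_prefix_setD {A : Type*} {X : Language A} (hX : IsPrefixCode X)
    {w : List A} (hwX : w ∉ X) {L M : List (List A)} {e f : List A}
    (hL : ∀ x ∈ L, x ∈ setD₀ X w) (hM : ∀ x ∈ M, x ∈ setD₀ X w)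
    (he : e ∈ setD₁ X w) (hf : f ∈ setD₁ X w) (h : L.flatten ++ e <+: M.flatten ++ f) :
    L.flatten ++ e = M.flatten ++ f :=
  (isPrefixCode_setD hX hwX).eq_of_flatten_append_prefix (D₀ := setD₀ X w) (D₁ := setD₁ X w)
    (fun _ hx => (mem_setD₀.1 hx).1) (fun _ hx => (mem_setD₁.1 hx).1)
    (fun _ hx hx' => (mem_setD₁.1 hx').2 (mem_setD₀.1 hx).2) he hf L M hL hM h

theorem isPrefixCode_internalTransformation {A : Type*} {S X : Language A} (hX : IsPrefixCode X)
    {w : List A} (hw : w ≠ []) (hwX : w ∉ X) (hD : ∃ d, d ∈ setD X w) :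
    IsPrefixCode (internalTransformation S X w) := by
  have hlen : 0 < w.length := List.length_pos_iff.2 hw
  constructor
  · rw [mem_internalTransformation, mem_setG₁_mul_kstar_mul_setD₁]
    rintro ⟨(h | h) | ⟨⟨g, -, L, -, e, -, h⟩, -⟩, -⟩
    · exact hX.1 h
    · exact hw h.symm
    · have := congrArg List.length h
      simp at this
      exact hw this.2.1
  obtain ⟨d, hd⟩ := hD
  intro x hx y hy hxy
  rw [mem_internalTransformation, mem_setG₁_mul_kstar_mul_setD₁] at hx hy
  obtain ⟨hx, hx'⟩ := hx
  obtain ⟨hy, hy'⟩ := hy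
  rcases hx with (hx | rfl) | ⟨⟨g, hg, L, hL, e, he, rfl⟩, -⟩
  · rcases hy with (hy | rfl) | ⟨⟨g, hg, L, hL, e, he, rfl⟩, -⟩
    · exact hX.2 x hx y hy hxy
    · have : x = y ++ d := hX.2 x hx _ hd (hxy.trans (List.prefix_append _ _))
      exact absurd ⟨hx, Or.inr (this ▸ List.prefix_append _ _)⟩ hx'
    · have : x = g ++ w := hX.eq_of_prefix_prefix hx (mem_setG₁.1 hg).1 hxy
        ⟨L.flatten ++ e, by simp⟩
      exact absurd ⟨hx, Or.inl (this ▸ List.suffix_append _ _)⟩ hx'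
  · rcases hy with (hy | rfl) | ⟨⟨g, hg, L, hL, e, he, rfl⟩, -⟩
    · exact absurd ⟨hy, Or.inr hxy⟩ hy'
    · rfl
    · refine absurd (List.prefix_of_prefix_length_le hxy ⟨L.flatten ++ e, ?_⟩ ?_)
        (mem_setG₁.1 hg).2 <;> simp
  · rcases hy with (hy | rfl) | ⟨⟨g', hg', L', hL', e', he', rfl⟩, -⟩
    · have h1 : g ++ w <+: y := List.IsPrefix.trans ⟨L.flatten ++ e, by simp⟩ hxy
      have h2 := hX.2 _ (mem_setG₁.1 hg).1 y hy h1
      exact absurd ⟨hy, Or.inl (h2 ▸ List.suffix_append _ _)⟩ hy'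
    · have h1 := hxy.length_le
      simp only [List.length_append] at h1
      have he0 : e = [] := List.eq_nil_of_length_eq_zero (by omega)
      have h2 := (mem_setD₁.1 he).1
      rw [he0, List.append_nil] at h2
      exact absurd h2 hwX
    · have hgw : g ++ w = g' ++ w := hX.eq_of_append_prefix (r := L.flatten ++ e)
        (t := L'.flatten ++ e') (mem_setG₁.1 hg).1 (mem_setG₁.1 hg').1 (by simpa using hxy)
      obtain rfl := List.append_cancel_right hgw
      rw [List.prefix_append_right_inj, List.prefix_append_right_inj] at hxy
      rw [eq_of_flatten_append_prefix_setD hX hwX hL hL' he he' hxy]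

theorem isBifixCode_internalTransformation {A : Type*} {S X : Language A} (hX : IsBifixCode X)
    {w : List A} (hw : w ≠ []) (hwX : w ∉ X) (hG : ∃ g, g ∈ setG X w) (hD : ∃ d, d ∈ setD X w) :
    IsBifixCode (internalTransformation S X w) := by
  refine ⟨isPrefixCode_internalTransformation hX.1 hw hwX hD, ?_⟩
  rw [← isPrefixCode_reverse, reverse_internalTransformation]
  refine isPrefixCode_internalTransformation hX.reverse.1 (by simpa using hw)
    (by simpa using hwX) ?_
  obtain ⟨g, hg⟩ := hG
  refine ⟨g.reverse, ?_⟩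
  change w.reverse ++ g.reverse ∈ X.reverse
  rw [← List.reverse_append, Language.reverse_mem_reverse]
  exact hg

/-- If a word `q w d₁ ⋯ dₙ e` of `S`, with `dᵢ ∈ D₀` and `e ∈ D₁`, has no suffix in the transformed
code, then it can be rewritten in the same form with `q w` having no suffix in `X`: a suffix of
`q w` in `X` is some `g w`; it has `g ∈ G₀`, as `g w d₁ ⋯ dₙ e` is not in the transformed code, and
so `g w = w d` with `d ∈ D₀`. -/
theorem exists_suffixFree_factorization {A : Type*} {S X : Language A}
    (hS : IsFactorial S) (hX : IsBifixCode X) {w : List A} (hwX : w ∉ X)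
    (hG : ∃ g, g ∈ setG X w) {e : List A} (he : e ∈ setD₁ X w) :
    ∀ (n : ℕ) (q : List A), q.length ≤ n → ∀ L : List (List A), (∀ x ∈ L, x ∈ setD₀ X w) →
      q ++ w ++ (L.flatten ++ e) ∈ S →
      (∀ t : List A, t <:+ q ++ w ++ (L.flatten ++ e) → t ∉ internalTransformation S X w) →
      ∃ (q' : List A) (L' : List (List A)), (∀ x ∈ L', x ∈ setD₀ X w) ∧
        q' ++ w ++ (L'.flatten ++ e) = q ++ w ++ (L.flatten ++ e) ∧
        ∀ t : List A, t <:+ q' ++ w → t ∉ X := by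
  intro n
  induction n with
  | zero =>
    intro q hq L hL _ _
    obtain rfl : q = [] := List.eq_nil_of_length_eq_zero (by omega)
    refine ⟨[], L, hL, rfl, fun t ht htX => ?_⟩
    obtain ⟨g, hg⟩ := hG
    have := hX.2.2 t htX (g ++ w) hg (ht.trans (by simp))
    have hlen := ht.length_le
    rw [this] at hlen
    simp only [List.length_append, List.length_nil] at hlen
    have hg0 : g = [] := List.eq_nil_of_length_eq_zero (by omega)
    rw [hg0] at hg
    exact hwX hg
  | succ n ih =>
    intro q hq L hL hqS hqY
    by_cases hfree : ∀ t : List A, t <:+ q ++ w → t ∉ X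
    · exact ⟨q, L, hL, rfl, hfree⟩
    push Not at hfree
    obtain ⟨t, ht, htX⟩ := hfree
    have hwt : w <:+ t := by
      rcases List.suffix_or_suffix_of_suffix (List.suffix_append q w) ht with h | h
      · exact h
      · -- A word of `X` cannot be a suffix of `w`, which is a proper suffix of a word of `X`.
        obtain ⟨g, hg⟩ := hG
        have := hX.2.2 t htX (g ++ w) hg (h.trans (List.suffix_append _ _))
        rw [this]
        exact List.suffix_append _ _
    obtain ⟨g, rfl⟩ := hwt
    obtain ⟨q₁, rfl⟩ : g <:+ q := List.suffix_append_self_iff.1 ht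
    have hg0 : 0 < g.length := List.length_pos_iff.2 fun h => hwX (by simpa [h] using htX)
    by_cases hg : g ∈ setG₁ X w
    · have hsuf : g ++ (w ++ (L.flatten ++ e)) <:+ q₁ ++ g ++ w ++ (L.flatten ++ e) :=
        ⟨q₁, by simp⟩
      refine absurd (mem_internalTransformation.2 ⟨Or.inr ⟨mem_setG₁_mul_kstar_mul_setD₁.2
        ⟨g, hg, L, hL, e, he, rfl⟩, hS _ hqS _ hsuf.isInfix⟩, ?_⟩) (hqY _ hsuf)
      rintro ⟨h, -⟩
      have h1 := hX.1.2 (g ++ w) htX _ h ⟨L.flatten ++ e, by simp⟩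
      have h2 := congrArg List.length h1
      simp only [List.length_append] at h2
      have he0 : e = [] := List.eq_nil_of_length_eq_zero (by omega)
      have h3 := (mem_setD₁.1 he).1
      rw [he0, List.append_nil] at h3
      exact hwX h3
    · have hpre : w <+: g ++ w := by
        by_contra h
        exact hg (mem_setG₁.2 ⟨htX, h⟩)
      obtain ⟨d, hd⟩ := hpre
      have hdD : d ∈ setD₀ X w := mem_setD₀.2 ⟨hd ▸ htX, g, hd.symm⟩
      have heq : q₁ ++ w ++ ((d :: L).flatten ++ e) = q₁ ++ g ++ w ++ (L.flatten ++ e) := by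
        calc q₁ ++ w ++ ((d :: L).flatten ++ e) = q₁ ++ (w ++ d) ++ (L.flatten ++ e) := by simp
          _ = _ := by rw [hd]; simp
      obtain ⟨q', L', hL', h1, h2⟩ := ih q₁ (by simp at hq; omega) (d :: L)
        (by simpa using ⟨hdD, hL⟩) (heq ▸ hqS) (heq ▸ hqY)
      exact ⟨q', L', hL', h1.trans heq, h2⟩

theorem encard_suffixFreePrefixes_internalTransformation_le {A : Type*} {S X : Language A}
    (hS : IsFactorial S) (hX : IsBifixCode X) {w : List A} (hwX : w ∉ X)
    (hG : ∃ g, g ∈ setG X w) {s : List A} (hs : s ∈ S) :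
    (suffixFreePrefixes (internalTransformation S X w) s).encard ≤
      (suffixFreePrefixes X s).encard := by
  set Y := internalTransformation S X w with hYdef
  have hwY : w ∈ Y := mem_internalTransformation.2 ⟨Or.inl (Or.inr rfl), fun h => hwX h.1⟩
  have hfact : ∀ p ∈ suffixFreePrefixes Y s \ suffixFreePrefixes X s,
      ∃ (q : List A) (L : List (List A)) (e : List A), (∀ x ∈ L, x ∈ setD₀ X w) ∧
        e ∈ setD₁ X w ∧ q ++ w ++ (L.flatten ++ e) = p ∧ ∀ t : List A, t <:+ q ++ w → t ∉ X := by
    rintro p ⟨⟨hps, hpY⟩, hpX⟩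
    obtain ⟨x, hx, hxX⟩ : ∃ x, x <:+ p ∧ x ∈ X := by
      by_contra! h
      exact hpX ⟨hps, h⟩
    have hnsuf : ¬ w <:+ x := fun h => hpY w (h.trans hx) hwY
    have hpre : w <+: x := by
      by_contra h
      exact hpY x hx (mem_internalTransformation.2 ⟨Or.inl (Or.inl hxX), fun h' => by tauto⟩)
    obtain ⟨e, rfl⟩ := hpre
    obtain ⟨q, rfl⟩ := hx
    have he : e ∈ setD₁ X w := mem_setD₁.2 ⟨hxX, hnsuf⟩
    obtain ⟨q', L, hL, h1, h2⟩ := exists_suffixFree_factorization hS hX hwX hG he q.length q le_rfl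
      [] (by simp) (by simpa using hS s hs _ hps.isInfix) (by simpa using hpY)
    exact ⟨q', L, e, hL, he, by simpa using h1, h2⟩
  choose! f L e hL he hp hfree using hfact
  -- `f p ++ w` is the image of `p`; it is a suffix-free prefix for `X` but not for `Y`, as `w ∈ Y`.
  have hdiff : (suffixFreePrefixes Y s \ suffixFreePrefixes X s).encard ≤
      (suffixFreePrefixes X s \ suffixFreePrefixes Y s).encard := by
    refine Set.encard_le_encard_of_injOn (f := fun p => f p ++ w) (fun p h => ⟨⟨?_, ?_⟩, ?_⟩) ?_
    · exact List.IsPrefix.trans ⟨_, hp p h⟩ h.1.1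
    · exact hfree p h
    · exact fun h' => h'.2 w (List.suffix_append _ _) hwY
    · intro p h p' h' heq
      simp only at heq
      have h1 := hp p h
      have h2 := hp p' h'
      rw [← heq] at h2
      rcases List.prefix_or_prefix_of_prefix h.1.1 h'.1.1 with hpp | hpp
      · rw [← h1, ← h2, List.prefix_append_right_inj] at hpp
        rw [← h1, ← h2, eq_of_flatten_append_prefix_setD hX.1 hwX (hL p h) (hL p' h') (he p h)
          (he p' h') hpp]
      · rw [← h1, ← h2, List.prefix_append_right_inj] at hpp
        rw [← h1, ← h2, eq_of_flatten_append_prefix_setD hX.1 hwX (hL p' h') (hL p h) (he p' h')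
          (he p h) hpp]
  rw [← Set.encard_sdiff_add_encard_inter _ (suffixFreePrefixes X s),
    ← Set.encard_sdiff_add_encard_inter (suffixFreePrefixes X s) (suffixFreePrefixes Y s),
    Set.inter_comm (suffixFreePrefixes X s)]
  gcongr

end BifixCode

theorem mainTheorem6 {A : Type*} [Finite A] (S : Language A)
    (hS : BifixCode.IsUniformlyRecurrent S) (X : Language A) (d : ℕ∞)
    (hXfin : Set.Finite {x : List A | x ∈ X}) (hX : BifixCode.IsMaximalBifixCode S X)
    (hd : BifixCode.degree S X = d) (w : List A) (hwS : w ∈ S) (hw : w ≠ [])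
    (hG₁ : ∃ g : List A, g ∈ BifixCode.setG₁ X w)
    (hD₁ : ∃ e : List A, e ∈ BifixCode.setD₁ X w) :
    Set.Finite {y : List A | y ∈ BifixCode.internalTransformation S X w} ∧
      BifixCode.IsMaximalBifixCode S (BifixCode.internalTransformation S X w) ∧
      BifixCode.degree S (BifixCode.internalTransformation S X w) ≤ d := by
  open BifixCode in
  have hG : ∃ g, g ∈ setG X w := hG₁.imp fun g hg => (mem_setG₁.1 hg).1
  have hD : ∃ e, e ∈ setD X w := hD₁.imp fun e he => (mem_setD₁.1 he).1
  have hwX : w ∉ X := by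
    intro hwX
    obtain ⟨g, hg⟩ := hG₁
    obtain ⟨hgX, hg⟩ := mem_setG₁.1 hg
    exact hg (hX.1.1.2.2 w hwX _ hgX (List.suffix_append g w) ▸ List.prefix_rfl)
  have hbif := isBifixCode_internalTransformation (S := S) hX.1.1 hw hwX hG hD
  have hle : internalTransformation S X w ≤ S := by
    intro y hy
    rcases (mem_internalTransformation.1 hy).1 with (h | rfl) | ⟨-, h⟩
    · exact hX.1.2 h
    · exact hwS
    · exact h
  have hdeg : degree S (internalTransformation S X w) ≤ degree S X := by
    refine iSup₂_mono fun s hs => ?_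
    rw [numParses_eq_encard hbif.1, numParses_eq_encard hX.1.1.1]
    exact encard_suffixFreePrefixes_internalTransformation_le hS.factorial hX.1.1 hwX hG hs
  have htop : degree S (internalTransformation S X w) < ⊤ :=
    hdeg.trans_lt (hX.degree_lt_top hS hXfin)
  exact ⟨finite_of_degree_lt_top hS ⟨w, hwS⟩ hbif hle htop,
    isMaximalBifixCode_of_degree_lt_top hS hbif hle htop, hd ▸ hdeg⟩
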